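/- Let $d\ge 2$, let $\mathbb S=\{\xi\in\mathbb R^d:|\xi|=1\}$ with its surface measure $dS$, and put $c_d=\sqrt{\pi}/(2\pi)^{d/2}$. Let $\mathcal H$ be the Hilbert space of Herglotz solutions of the Helmholtz equation $\Delta u+u=0$ in $\mathbb R^d$, that is, of the functions $$u(x)=(I\varphi)(x)=c_d\int_{\mathbb S}\varphi(\xi)e^{ix\cdot\xi}\,dS(\xi),\qquad \varphi\in L_2(\mathbb S),$$ with the norm and the scalar product $\langle\cdot,\cdot\rangle$ for which $I:L_2(\mathbb S)\to\mathcal H$ is unitary, and let $\kappa_x\in\mathcal H$ be its reproducing kernel, $u(x)=\langle u,\kappa_x\rangle$ for all $u\in\mathcal H$, $x\in\mathbb R^d$. Let $a:\mathbb R^d\to\mathbb C$ be locally integrable and homogeneously dominated of degree $\lambda<-1$, i.e. there are constants $A$, $R$ such that $|a(x)|\le A|x|^{\lambda}$ for almost all $x$ with $|x|\ge R$. Then $a u\bar v$ is integrable on $\mathbb R^d$ for all $u,v\in\mathcal H$, and the sesquilinear form $$F_a(u,v)=\int_{\mathbb R^d}a(x)u(x)\overline{v(x)}\,dx$$ is bounded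 in $\mathcal H$: there is a constant $C$ with $|F_a(u,v)|\le C\|u\|\,\|v\|$ for all $u,v\in\mathcal H$. Hence the Toeplitz operator $(T_au)(x)=F_a(u,\kappa_x)$ is a bounded linear operator in $\mathcal H$, and $\langle T_au,v\rangle=F_a(u,v)$ for all $u,v\in\mathcal H$. -/

import Mathlib

open MeasureTheory
open scoped ComplexConjugate

noncomputable section

/-- Surface (Lebesgue) measure `dS` on the unit sphere of `ℝ^d`. -/
def surfaceMeasure (d : ℕ) :
    Measure (Metric.sphere (0 : EuclideanSpace ℝ (Fin d)) 1) :=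
  (volume : Measure (EuclideanSpace ℝ (Fin d))).toSphere

instance (d : ℕ) : IsFiniteMeasure (surfaceMeasure d) := by
  unfold surfaceMeasure; infer_instance

/-- The constant `c_d = √π / (2π)^{d/2}`. -/
def herglotzConst (d : ℕ) : ℝ := √Real.pi / (2 * Real.pi) ^ ((d : ℝ) / 2)

/-- The plane wave `ξ ↦ e^{i x·ξ}` on the unit sphere. -/
def planeWave {d : ℕ} (x : EuclideanSpace ℝ (Fin d)) :
    C(Metric.sphere (0 : EuclideanSpace ℝ (Fin d)) 1, ℂ) where
  toFun ξ := Complex.exp (Complex.I * (inner ℝ x (ξ : EuclideanSpace ℝ (Fin d)) : ℝ))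
  continuous_toFun := by fun_prop

theorem norm_planeWave {d : ℕ} (x : EuclideanSpace ℝ (Fin d))
    (ξ : Metric.sphere (0 : EuclideanSpace ℝ (Fin d)) 1) : ‖planeWave x ξ‖ = 1 := by
  simp [planeWave, mul_comm Complex.I, Complex.norm_exp_ofReal_mul_I]

theorem integrable_mul_planeWave {d : ℕ} (φ : Lp ℂ 2 (surfaceMeasure d))
    (x : EuclideanSpace ℝ (Fin d)) :
    Integrable (fun ξ => φ ξ * planeWave x ξ) (surfaceMeasure d) :=
  ((Lp.memLp φ).integrable (by norm_num)).mul_bdd (c := 1)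
    (planeWave x).continuous.aestronglyMeasurable
    (Filter.Eventually.of_forall fun ξ => (norm_planeWave x ξ).le)

/-- The operator `(I φ)(x) = c_d ∫_S φ(ξ) e^{i x·ξ} dS(ξ)` on `L₂(S)`. -/
def herglotzTransform (d : ℕ) :
    Lp ℂ 2 (surfaceMeasure d) →ₗ[ℂ] (EuclideanSpace ℝ (Fin d) → ℂ) where
  toFun φ x := (herglotzConst d : ℂ) * ∫ ξ, φ ξ * planeWave x ξ ∂(surfaceMeasure d)
  map_add' φ ψ := by
    funext x
    rw [Pi.add_apply, ← mul_add,
      ← integral_add (integrable_mul_planeWave φ x) (integrable_mul_planeWave ψ x)]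
    congr 1
    apply integral_congr_ae
    filter_upwards [Lp.coeFn_add φ ψ] with ξ hξ
    rw [hξ, Pi.add_apply, add_mul]
  map_smul' c φ := by
    funext x
    rw [Pi.smul_apply, RingHom.id_apply, smul_eq_mul, mul_left_comm,
      ← integral_const_mul c]
    congr 1
    apply integral_congr_ae
    filter_upwards [Lp.coeFn_smul c φ] with ξ hξ
    rw [hξ, Pi.smul_apply, smul_eq_mul, mul_assoc]

theorem herglotzTransform_apply {d : ℕ} (φ : Lp ℂ 2 (surfaceMeasure d))
    (x : EuclideanSpace ℝ (Fin d)) :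
    herglotzTransform d φ x
      = (herglotzConst d : ℂ) * ∫ ξ, φ ξ * planeWave x ξ ∂(surfaceMeasure d) := rfl

theorem herglotzConst_pos (d : ℕ) : 0 < herglotzConst d := by
  unfold herglotzConst; positivity

/-- `(I φ)(x)` is `c_d` times the scalar product of `φ` with the plane wave `e^{-i x·ξ}`. -/
theorem herglotzTransform_eq_inner {d : ℕ} (φ : Lp ℂ 2 (surfaceMeasure d))
    (x : EuclideanSpace ℝ (Fin d)) :
    herglotzTransform d φ x
      = (herglotzConst d : ℂ) *
        inner ℂ (ContinuousMap.toLp 2 (surfaceMeasure d) ℂ (planeWave (-x))) φ := by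
  rw [herglotzTransform_apply, L2.inner_def]
  congr 1
  apply integral_congr_ae
  filter_upwards [ContinuousMap.coeFn_toLp (p := 2) (𝕜 := ℂ) (surfaceMeasure d)
    (planeWave (-x))] with ξ hξ
  rw [hξ, RCLike.inner_apply]
  congr 1
  simp [planeWave, ← Complex.exp_conj]

theorem planeWave_add {d : ℕ} (x y : EuclideanSpace ℝ (Fin d)) :
    planeWave (x + y) = planeWave x * planeWave y := by
  ext ξ
  simp [planeWave, inner_add_left, mul_add, Complex.exp_add]

theorem planeWave_neg {d : ℕ} (x : EuclideanSpace ℝ (Fin d)) :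
    planeWave (-x) = star (planeWave x) := by
  ext ξ
  simp [planeWave, ← Complex.exp_conj]

theorem planeWave_zero {d : ℕ} : planeWave (0 : EuclideanSpace ℝ (Fin d)) = 1 := by
  ext ξ
  simp [planeWave]

/-- Trigonometric polynomials on the sphere. -/
def planeWaveAlgebra (d : ℕ) :
    StarSubalgebra ℂ C(Metric.sphere (0 : EuclideanSpace ℝ (Fin d)) 1, ℂ) :=
  StarAlgebra.adjoin ℂ (Set.range planeWave)

theorem planeWave_separates {d : ℕ} {ξ η : Metric.sphere (0 : EuclideanSpace ℝ (Fin d)) 1}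
    (h : ξ ≠ η) : ∃ x : EuclideanSpace ℝ (Fin d), planeWave x ξ ≠ planeWave x η := by
  set v : EuclideanSpace ℝ (Fin d) := (ξ : EuclideanSpace ℝ (Fin d)) - η with hv
  have hv0 : v ≠ 0 := sub_ne_zero.2 fun h' => h (Subtype.ext h')
  have hvv : inner ℝ v v ≠ (0 : ℝ) := inner_self_ne_zero.2 hv0
  refine ⟨(Real.pi / inner ℝ v v) • v, fun he => ?_⟩
  have h1 : Complex.exp (Complex.I * Real.pi) = 1 := by
    have h2 : planeWave ((Real.pi / inner ℝ v v) • v) ξ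
        = planeWave ((Real.pi / inner ℝ v v) • v) η * Complex.exp (Complex.I * Real.pi) := by
      simp only [planeWave, ContinuousMap.coe_mk, ← Complex.exp_add, ← mul_add]
      congr 2
      norm_cast
      have h3 : (ξ : EuclideanSpace ℝ (Fin d)) = η + v := by rw [hv]; abel
      rw [h3, inner_add_right]
      congr 1
      rw [real_inner_smul_left, div_mul_cancel₀ _ hvv]
    have h4 : planeWave ((Real.pi / inner ℝ v v) • v) η ≠ 0 := by
      rw [← norm_ne_zero_iff, norm_planeWave]; norm_num
    rw [he] at h2
    exact (mul_eq_left₀ h4).1 h2.symm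
  rw [mul_comm, Complex.exp_pi_mul_I] at h1
  norm_num at h1

theorem planeWaveAlgebra_dense (d : ℕ) : (planeWaveAlgebra d).topologicalClosure = ⊤ := by
  apply ContinuousMap.starSubalgebra_topologicalClosure_eq_top_of_separatesPoints
  intro ξ η h
  obtain ⟨x, hx⟩ := planeWave_separates h
  exact ⟨planeWave x, ⟨planeWave x, StarAlgebra.subset_adjoin ℂ _ ⟨x, rfl⟩, rfl⟩, hx⟩

theorem planeWaveAlgebra_le_span (d : ℕ)
    {f : C(Metric.sphere (0 : EuclideanSpace ℝ (Fin d)) 1, ℂ)} (hf : f ∈ planeWaveAlgebra d) :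
    f ∈ Submodule.span ℂ (Set.range (planeWave (d := d))) := by
  have hf' : f ∈ (planeWaveAlgebra d).toSubalgebra := hf
  rw [planeWaveAlgebra, StarAlgebra.adjoin_toSubalgebra] at hf'
  have hstar : star (Set.range (planeWave (d := d))) ⊆ Set.range planeWave := by
    rintro g ⟨x, hx⟩
    exact ⟨-x, by rw [planeWave_neg, hx, star_star]⟩
  rw [Set.union_eq_self_of_subset_right hstar] at hf'
  let M : Submonoid C(Metric.sphere (0 : EuclideanSpace ℝ (Fin d)) 1, ℂ) :=
    { carrier := Set.range planeWave
      mul_mem' := by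
        rintro _ _ ⟨x, rfl⟩ ⟨y, rfl⟩
        exact ⟨x + y, planeWave_add x y⟩
      one_mem' := ⟨0, planeWave_zero⟩ }
  have hM : Submonoid.closure (Set.range (planeWave (d := d))) = M := M.closure_eq
  have h2 : f ∈ Subalgebra.toSubmodule (Algebra.adjoin ℂ (Set.range (planeWave (d := d)))) := hf'
  rw [Algebra.adjoin_eq_span, hM] at h2
  exact h2

/-- A Herglotz function has only one density: `I` is injective. -/
theorem herglotzTransform_injective (d : ℕ) : Function.Injective (herglotzTransform d) := by
  rw [injective_iff_map_eq_zero]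
  intro φ hφ
  set L := ContinuousMap.toLp (E := ℂ) 2 (surfaceMeasure d) ℂ with hL
  have h1 : ∀ x, inner ℂ (L (planeWave x)) φ = 0 := by
    intro x
    have h := congrFun hφ (-x)
    rw [herglotzTransform_eq_inner, neg_neg, Pi.zero_apply] at h
    exact (mul_eq_zero.1 h).resolve_left (by exact_mod_cast (herglotzConst_pos d).ne')
  have h2 : ∀ f ∈ Submodule.span ℂ (Set.range (planeWave (d := d))), inner ℂ (L f) φ = 0 := by
    intro f hf
    induction hf using Submodule.span_induction with
    | mem f hf => obtain ⟨x, rfl⟩ := hf; exact h1 x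
    | zero => simp
    | add f g _ _ hf hg => rw [map_add, inner_add_left, hf, hg, add_zero]
    | smul c f _ hf => rw [map_smul, inner_smul_left, hf, mul_zero]
  have h3 : ∀ f, inner ℂ (L f) φ = 0 := by
    have hclosed : IsClosed {f | inner ℂ (L f) φ = 0} :=
      isClosed_eq (by fun_prop) continuous_const
    intro f
    have hf : f ∈ (planeWaveAlgebra d).topologicalClosure := by
      rw [planeWaveAlgebra_dense]; trivial
    rw [← SetLike.mem_coe, StarSubalgebra.topologicalClosure_coe] at hf
    exact closure_minimal (fun g hg => h2 g (planeWaveAlgebra_le_span d hg)) hclosed hf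
  have hd : DenseRange L := by
    have : (surfaceMeasure d).WeaklyRegular := inferInstance
    exact ContinuousMap.toLp_denseRange ℂ (surfaceMeasure d) ℂ (by norm_num)
  have h4 : ∀ ψ, inner ℂ ψ φ = 0 := fun ψ =>
    hd.induction_on (p := fun ψ => inner ℂ ψ φ = 0) ψ
      (isClosed_eq (by fun_prop) continuous_const) h3
  exact inner_self_eq_zero.1 (h4 φ)

/-- The space `ℋ` of Herglotz solutions of the Helmholtz equation on `ℝ^d`: the functions
`u = I φ` with `φ ∈ L₂(S)`. -/
def HerglotzSpace (d : ℕ) : Type := LinearMap.range (herglotzTransform d)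

namespace HerglotzSpace

instance (d : ℕ) : AddCommGroup (HerglotzSpace d) :=
  inferInstanceAs (AddCommGroup (LinearMap.range (herglotzTransform d)))

instance (d : ℕ) : Module ℂ (HerglotzSpace d) :=
  inferInstanceAs (Module ℂ (LinearMap.range (herglotzTransform d)))

/-- An element of `ℋ` as a function on `ℝ^d`. -/
def toFunLinear (d : ℕ) : HerglotzSpace d →ₗ[ℂ] (EuclideanSpace ℝ (Fin d) → ℂ) :=
  (LinearMap.range (herglotzTransform d)).subtype

/-- `I` as a linear bijection of `L₂(S)` onto `ℋ`. -/
def ofDensity (d : ℕ) : Lp ℂ 2 (surfaceMeasure d) ≃ₗ[ℂ] HerglotzSpace d :=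
  LinearEquiv.ofInjective (herglotzTransform d) (herglotzTransform_injective d)

theorem toFunLinear_ofDensity {d : ℕ} (φ : Lp ℂ 2 (surfaceMeasure d)) :
    toFunLinear d (ofDensity d φ) = herglotzTransform d φ := rfl

/-- The norm of `ℋ` is the one that makes `I` isometric: `‖I φ‖ = ‖φ‖_{L₂(S)}`. -/
instance (d : ℕ) : NormedAddCommGroup (HerglotzSpace d) :=
  NormedAddCommGroup.induced (HerglotzSpace d) (Lp ℂ 2 (surfaceMeasure d))
    (ofDensity d).symm (ofDensity d).symm.injective

theorem norm_def {d : ℕ} (u : HerglotzSpace d) : ‖u‖ = ‖(ofDensity d).symm u‖ := rfl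

/-- The scalar product of `ℋ`: `⟨I φ, I ψ⟩ = ⟨φ, ψ⟩_{L₂(S)}`. -/
instance (d : ℕ) : InnerProductSpace ℂ (HerglotzSpace d) where
  norm_smul_le c u := by rw [norm_def, norm_def, map_smul, norm_smul]
  inner u v := inner ℂ ((ofDensity d).symm u) ((ofDensity d).symm v)
  norm_sq_eq_re_inner u := by rw [norm_def, norm_sq_eq_re_inner (𝕜 := ℂ)]
  conj_inner_symm u v := inner_conj_symm _ _
  add_left u v w := by rw [map_add, inner_add_left]
  smul_left u v c := by rw [map_smul, inner_smul_left]

/-- `I` as a unitary operator of `L₂(S)` onto `ℋ`. -/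
def ofDensityIsometry (d : ℕ) : Lp ℂ 2 (surfaceMeasure d) ≃ₗᵢ[ℂ] HerglotzSpace d where
  toLinearEquiv := ofDensity d
  norm_map' φ := by rw [norm_def, LinearEquiv.symm_apply_apply]

instance (d : ℕ) : CompleteSpace (HerglotzSpace d) :=
  (ofDensityIsometry d).symm.toIsometryEquiv.completeSpace

/-- `ℋ` is a reproducing kernel Hilbert space of functions on `ℝ^d`; its reproducing kernel
`κ_x` is `RKHS.kerFun (HerglotzSpace d) x 1`. -/
instance (d : ℕ) : RKHS ℂ (HerglotzSpace d) (EuclideanSpace ℝ (Fin d)) ℂ where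
  coeCLM :=
    { toLinearMap := toFunLinear d
      cont := by
        refine continuous_pi fun x => ?_
        have h : (fun u : HerglotzSpace d => toFunLinear d u x) = fun u =>
            (herglotzConst d : ℂ) *
              inner ℂ (ContinuousMap.toLp 2 (surfaceMeasure d) ℂ (planeWave (-x)))
                ((ofDensityIsometry d).symm u) := by
          funext u
          rw [← herglotzTransform_eq_inner, ← toFunLinear_ofDensity]
          exact congrArg (fun w => toFunLinear d w x)
            ((ofDensityIsometry d).apply_symm_apply u).symm
        change Continuous fun u : HerglotzSpace d => toFunLinear d u x
        rw [h]
        fun_prop }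
  coeCLM_injective := Subtype.val_injective

/-- The elements of `ℋ` are the functions `x ↦ c_d ∫_S φ(ξ) e^{i x·ξ} dS(ξ)`. -/
theorem ofDensity_apply {d : ℕ} (φ : Lp ℂ 2 (surfaceMeasure d))
    (x : EuclideanSpace ℝ (Fin d)) :
    ofDensity d φ x = (herglotzConst d : ℂ) * ∫ ξ, φ ξ *
      Complex.exp (Complex.I * (inner ℝ x (ξ : EuclideanSpace ℝ (Fin d)) : ℝ))
        ∂(surfaceMeasure d) := rfl

end HerglotzSpace

/-- The sesquilinear form `F_a(u, v) = ∫ a(x) u(x) conj(v(x)) dx` on `ℋ`. -/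
def symbolForm {d : ℕ} (a : EuclideanSpace ℝ (Fin d) → ℂ) (u v : HerglotzSpace d) : ℂ :=
  ∫ x, a x * u x * conj (v x)

/-- A bounded sesquilinear form: linear in `u`, antilinear in `v`, `|F(u, v)| ≤ C ‖u‖ ‖v‖`. -/
structure IsBoundedSesquilinearForm {d : ℕ} (F : HerglotzSpace d → HerglotzSpace d → ℂ) :
    Prop where
  add_left : ∀ u₁ u₂ v, F (u₁ + u₂) v = F u₁ v + F u₂ v
  smul_left : ∀ (c : ℂ) u v, F (c • u) v = c * F u v
  add_right : ∀ u v₁ v₂, F u (v₁ + v₂) = F u v₁ + F u v₂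
  smul_right : ∀ (c : ℂ) u v, F u (c • v) = conj c * F u v
  bound : ∃ C : ℝ, ∀ u v, ‖F u v‖ ≤ C * ‖u‖ * ‖v‖

/-- The function `(T_F u)(x) = F(u, κ_x)`, with `κ_x` the reproducing kernel of `ℋ`. -/
def toeplitzFun {d : ℕ} (F : HerglotzSpace d → HerglotzSpace d → ℂ) (u : HerglotzSpace d) :
    EuclideanSpace ℝ (Fin d) → ℂ :=
  fun x => F u (RKHS.kerFun (HerglotzSpace d) x 1)

/-- `a` is homogeneously dominated of degree `lam`: it is locally integrable and
`|a(x)| ≤ A |x|^lam` for (almost) all `x` with `|x|` sufficiently large. -/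
def IsHomogeneouslyDominated {d : ℕ} (a : EuclideanSpace ℝ (Fin d) → ℂ) (lam : ℝ) : Prop :=
  LocallyIntegrable a volume ∧
    ∃ A R : ℝ, ∀ᵐ x : EuclideanSpace ℝ (Fin d), R ≤ ‖x‖ → ‖a x‖ ≤ A * ‖x‖ ^ lam

end

/-! Everything reduces to the Carleson-type bound `∫ |a| |u|² ≤ K ‖u‖²`. Polarised by
Cauchy–Schwarz, it gives integrability of `a u v̄` and boundedness of `F_a`; Riesz representation
then produces `T`, and pairing `T u` with `κ_x` identifies its values. On a large ball the Carleson
bound follows from local integrability of `a` and the uniform boundedness of point evaluations.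
Outside the ball `|a|` is dominated by a multiple of `(1 + |x|²)^(-s)` with `s = -λ/2 > 1/2`, so a
weighted `L²` estimate is needed for `u = I φ`. That estimate starts from Gaussian weights.
Expanding `|u|²` and applying Fubini turns `∫ exp(-ε|x|²) |u|²` into a quadratic form in `φ` with
the positive kernel `(π/ε)^(d/2) exp(-|ξ-η|²/(4ε))` on the sphere. The sphere has codimension one,
so the Gaussian has mass `O(ε^((d-1)/2))` on it, and Schur's test bounds the form by `D ε^(-1/2)
‖φ‖²`. Since `Γ(s) (1 + |x|²)^(-s) = ∫₀^∞ t^(s-1) exp(-(1 + |x|²) t) dt`, integrating the Gaussian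
bounds over `ε = t` leaves `Γ(s - 1/2)`, which is finite exactly because `s > 1/2`. See
`exists_lintegral_gaussian_mul_herglotzTransform_le` and
`exists_lintegral_rpow_mul_herglotzTransform_le`. -/

/-! ### Gaussian mass on the sphere -/

/-- Integrals over the unit sphere are controlled by integrals over thin spherical shells. -/
theorem lintegral_toSphere_le_shell {E : Type*} [NormedAddCommGroup E] [NormedSpace ℝ E]
    [MeasurableSpace E] [BorelSpace E] [FiniteDimensional ℝ E] (μ : Measure E)
    [μ.IsAddHaarMeasure] {f : Metric.sphere (0 : E) 1 → ENNReal} (hf : Measurable f)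
    {g : E → ENNReal} {t : ℝ}
    (hfg : ∀ ξ : Metric.sphere (0 : E) 1, ∀ r ∈ Set.Ioo 1 (1 + t), f ξ ≤ g (r • (ξ : E))) :
    (∫⁻ ξ, f ξ ∂μ.toSphere) * ENNReal.ofReal t ≤ ∫⁻ x, g x ∂μ := by
  set S : Set (Set.Ioi (0 : ℝ)) := Subtype.val ⁻¹' Set.Ioo 1 (1 + t) with hS
  have hSm : MeasurableSet S := measurable_subtype_coe measurableSet_Ioo
  -- In polar coordinates the radial measure has density `r^(n-1)`, which is at least 1 for `r > 1`;
  -- this is why the shell lies outside the sphere.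
  have hvol : ENNReal.ofReal t ≤ Measure.volumeIoiPow (Module.finrank ℝ E - 1) S := by
    rw [Measure.volumeIoiPow, withDensity_apply _ hSm]
    calc ENNReal.ofReal t
        = (Measure.comap Subtype.val volume : Measure (Set.Ioi (0 : ℝ))) S := by
          rw [comap_subtype_coe_apply measurableSet_Ioi, hS, Subtype.image_preimage_coe,
            Set.inter_eq_right.2
              (show Set.Ioo 1 (1 + t) ⊆ Set.Ioi 0 from fun r hr => lt_trans one_pos hr.1), Real.volume_Ioo]
          simp
      _ = ∫⁻ _ in S, 1 ∂(Measure.comap Subtype.val volume : Measure (Set.Ioi (0 : ℝ))) := by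
          simp
      _ ≤ _ := by
          refine setLIntegral_mono' hSm fun r hr => ?_
          rw [← ENNReal.ofReal_one]
          exact ENNReal.ofReal_le_ofReal (one_le_pow₀ hr.1.le)
  calc (∫⁻ ξ, f ξ ∂μ.toSphere) * ENNReal.ofReal t
      ≤ (∫⁻ ξ, f ξ ∂μ.toSphere) *
          ∫⁻ r, S.indicator 1 r ∂Measure.volumeIoiPow (Module.finrank ℝ E - 1) := by
        rw [lintegral_indicator_one hSm]
        gcongr
    _ = ∫⁻ p, f p.1 * S.indicator 1 p.2
          ∂μ.toSphere.prod (Measure.volumeIoiPow (Module.finrank ℝ E - 1)) :=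
        (lintegral_prod_mul hf.aemeasurable
          (measurable_one.indicator hSm).aemeasurable).symm
    _ = ∫⁻ x : ({0}ᶜ : Set E), f (homeomorphUnitSphereProd E x).1 *
          S.indicator 1 (homeomorphUnitSphereProd E x).2 ∂(μ.comap Subtype.val) :=
        (μ.measurePreserving_homeomorphUnitSphereProd.lintegral_comp_emb
          (Homeomorph.measurableEmbedding _) _).symm
    _ ≤ ∫⁻ x : ({0}ᶜ : Set E), g x ∂(μ.comap Subtype.val) := by
        refine lintegral_mono fun x => ?_
        by_cases hx : (homeomorphUnitSphereProd E x).2 ∈ S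
        · rw [Set.indicator_of_mem hx, Pi.one_apply, mul_one]
          refine (hfg _ _ hx).trans_eq (congrArg g ?_)
          have h0 : ‖(x : E)‖ ≠ 0 := norm_ne_zero_iff.2 x.2
          simp [smul_smul, h0]
        · simp [hx]
    _ = ∫⁻ x in ({0}ᶜ : Set E), g x ∂μ :=
        lintegral_subtype_comap (measurableSet_singleton _).compl g
    _ ≤ ∫⁻ x, g x ∂μ := setLIntegral_le_lintegral _ _

theorem lintegral_exp_neg_mul_sq_norm_sub {d : ℕ} {b : ℝ} (hb : 0 < b)
    (y : EuclideanSpace ℝ (Fin d)) :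
    ∫⁻ x : EuclideanSpace ℝ (Fin d), ENNReal.ofReal (Real.exp (-b * ‖x - y‖ ^ 2))
      = ENNReal.ofReal ((Real.pi / b) ^ ((d : ℝ) / 2)) := by
  rw [lintegral_sub_right_eq_self
    (fun x : EuclideanSpace ℝ (Fin d) => ENNReal.ofReal (Real.exp (-b * ‖x‖ ^ 2))) y,
    ← ofReal_integral_eq_lintegral_ofReal,
    GaussianFourier.integral_rexp_neg_mul_sq_norm hb, finrank_euclideanSpace_fin]
  · have h := (GaussianFourier.integrable_cexp_neg_mul_sq_norm_add (b := (b : ℂ)) (by simpa using hb) 0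
      (0 : EuclideanSpace ℝ (Fin d))).re
    refine h.congr (Filter.Eventually.of_forall fun x => ?_)
    simp only [zero_mul, add_zero]
    rw [← Complex.ofReal_neg, ← Complex.ofReal_pow, ← Complex.ofReal_mul]
    exact Complex.exp_ofReal_re _
  · exact Filter.Eventually.of_forall fun x => (Real.exp_pos _).le

/-- A Gaussian of width `√ε` centred on the sphere has mass `O(ε^{(d-1)/2})` there. -/
theorem lintegral_sphere_gaussian_le {d : ℕ} {ε : ℝ} (hε : 0 < ε)
    {y : EuclideanSpace ℝ (Fin d)} :
    (∫⁻ ξ, ENNReal.ofReal (Real.exp (-‖(ξ : EuclideanSpace ℝ (Fin d)) - y‖ ^ 2 / (4 * ε)))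
        ∂surfaceMeasure d) * ENNReal.ofReal (√ε)
      ≤ ENNReal.ofReal (Real.exp (1 / 4) * (Real.pi * (8 * ε)) ^ ((d : ℝ) / 2)) := by
  -- The shell has thickness `√ε`, the scale of the Gaussian. Moving by less than `√ε` gives `|rξ -
  -- y|² ≤ 2ε + 2|ξ - y|²`; replacing `4ε` by `8ε` absorbs the factor 2, and `2ε/(8ε)` is the `1/4`
  -- in the constant.
  refine (lintegral_toSphere_le_shell (E := EuclideanSpace ℝ (Fin d)) volume
    (g := fun x => ENNReal.ofReal (Real.exp (1 / 4)) *
      ENNReal.ofReal (Real.exp (-(1 / (8 * ε)) * ‖x - y‖ ^ 2))) (by fun_prop) ?_).trans_eq ?_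
  · intro ξ r hr
    rw [← ENNReal.ofReal_mul (Real.exp_pos _).le, ← Real.exp_add]
    refine ENNReal.ofReal_le_ofReal (Real.exp_le_exp.2 ?_)
    have hξ : ‖(ξ : EuclideanSpace ℝ (Fin d))‖ = 1 := by simp
    have h1 : ‖r • (ξ : EuclideanSpace ℝ (Fin d)) - y‖
        ≤ √ε + ‖(ξ : EuclideanSpace ℝ (Fin d)) - y‖ := by
      have h2 : r • (ξ : EuclideanSpace ℝ (Fin d)) - y
          = (r - 1) • (ξ : EuclideanSpace ℝ (Fin d)) + (ξ - y) := by
        rw [sub_smul, one_smul]; abel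
      rw [h2]
      refine (norm_add_le _ _).trans ?_
      rw [norm_smul, hξ, mul_one, Real.norm_of_nonneg (by linarith [hr.1])]
      linarith [hr.2]
    have h3 : ‖r • (ξ : EuclideanSpace ℝ (Fin d)) - y‖ ^ 2
        ≤ 2 * ε + 2 * ‖(ξ : EuclideanSpace ℝ (Fin d)) - y‖ ^ 2 := by
      have := pow_le_pow_left₀ (norm_nonneg _) h1 2
      nlinarith [Real.sq_sqrt hε.le, sq_nonneg (√ε - ‖(ξ : EuclideanSpace ℝ (Fin d)) - y‖)]
    have h4 : -(1 / (8 * ε)) * (2 * ε + 2 * ‖(ξ : EuclideanSpace ℝ (Fin d)) - y‖ ^ 2)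
        ≤ -(1 / (8 * ε)) * ‖r • (ξ : EuclideanSpace ℝ (Fin d)) - y‖ ^ 2 :=
      mul_le_mul_of_nonpos_left h3 (neg_nonpos.2 (by positivity))
    refine le_trans (le_of_eq ?_) (add_le_add_right h4 _)
    field_simp
    ring
  · rw [lintegral_const_mul _ (by fun_prop), lintegral_exp_neg_mul_sq_norm_sub (by positivity),
      ← ENNReal.ofReal_mul (Real.exp_pos _).le]
    congr 4
    field_simp

/-! ### Elementary properties of `I φ` and of its density -/

theorem norm_herglotzTransform_le {d : ℕ} (φ : Lp ℂ 2 (surfaceMeasure d))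
    (x : EuclideanSpace ℝ (Fin d)) :
    ‖herglotzTransform d φ x‖ ≤ herglotzConst d * ∫ ξ, ‖φ ξ‖ ∂surfaceMeasure d := by
  rw [herglotzTransform_apply, norm_mul, Complex.norm_of_nonneg (herglotzConst_pos d).le]
  refine mul_le_mul_of_nonneg_left ((norm_integral_le_integral_norm _).trans_eq ?_)
    (herglotzConst_pos d).le
  simp [norm_planeWave]

theorem continuous_herglotzTransform {d : ℕ} (φ : Lp ℂ 2 (surfaceMeasure d)) :
    Continuous (herglotzTransform d φ) := by
  refine continuous_const.mul (continuous_of_dominated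
    (fun x => (integrable_mul_planeWave φ x).aestronglyMeasurable)
    (bound := fun ξ => ‖φ ξ‖) (fun x => Filter.Eventually.of_forall fun ξ => ?_)
    ((Lp.memLp φ).integrable (by norm_num)).norm (Filter.Eventually.of_forall fun ξ => ?_))
  · simp [norm_planeWave]
  · simp only [planeWave, ContinuousMap.coe_mk]
    fun_prop

theorem lintegral_enorm_sq_eq {d : ℕ} (φ : Lp ℂ 2 (surfaceMeasure d)) :
    ∫⁻ ξ, ‖φ ξ‖ₑ ^ 2 ∂surfaceMeasure d = ‖φ‖ₑ ^ 2 := by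
  have h := eLpNorm_nnreal_pow_eq_lintegral (f := φ) (μ := surfaceMeasure d)
    (p := 2) (by norm_num)
  have h2 : ‖φ‖ₑ = eLpNorm φ 2 (surfaceMeasure d) := Lp.enorm_def φ
  rw [h2]
  simpa using h.symm

/-! ### Gaussian-weighted trace estimate -/

/-- Schur's test for a symmetric kernel. -/
theorem lintegral_prod_mul_mul_le_of_schur {X : Type*} [MeasurableSpace X] {μ : Measure X}
    [SFinite μ] {f : X → ENNReal} (hf : AEMeasurable f μ) {k : X → X → ENNReal}
    (hk : Measurable (Function.uncurry k)) {M : ENNReal}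
    (hl : ∀ x, ∫⁻ y, k x y ∂μ ≤ M) (hr : ∀ y, ∫⁻ x, k x y ∂μ ≤ M) :
    ∫⁻ p : X × X, f p.1 * f p.2 * k p.1 p.2 ∂μ.prod μ ≤ 2 * M * ∫⁻ x, f x ^ 2 ∂μ := by
  have hk' : Measurable fun p : X × X => k p.1 p.2 := hk
  have hm1 : AEMeasurable (fun p : X × X => f p.1 ^ 2 * k p.1 p.2) (μ.prod μ) :=
    (hf.comp_fst.pow_const 2).mul hk'.aemeasurable
  have hm2 : AEMeasurable (fun p : X × X => f p.2 ^ 2 * k p.1 p.2) (μ.prod μ) :=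
    (hf.comp_snd.pow_const 2).mul hk'.aemeasurable
  have h1 : ∫⁻ p : X × X, f p.1 ^ 2 * k p.1 p.2 ∂μ.prod μ ≤ M * ∫⁻ x, f x ^ 2 ∂μ := by
    rw [lintegral_prod _ hm1,
      ← lintegral_const_mul'' _ (hf.pow_const 2)]
    refine lintegral_mono fun x => ?_
    change ∫⁻ y, f x ^ 2 * k x y ∂μ ≤ M * f x ^ 2
    rw [lintegral_const_mul _ (show Measurable fun y => k x y from hk.comp measurable_prodMk_left), mul_comm]
    gcongr
    exact hl x
  have h2 : ∫⁻ p : X × X, f p.2 ^ 2 * k p.1 p.2 ∂μ.prod μ ≤ M * ∫⁻ x, f x ^ 2 ∂μ := by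
    rw [lintegral_prod_symm _ hm2,
      ← lintegral_const_mul'' _ (hf.pow_const 2)]
    refine lintegral_mono fun y => ?_
    change ∫⁻ x, f y ^ 2 * k x y ∂μ ≤ M * f y ^ 2
    rw [lintegral_const_mul _ (show Measurable fun x => k x y from hk.comp measurable_prodMk_right), mul_comm]
    gcongr
    exact hr y
  -- The crude bound `ab ≤ max(a, b)² ≤ a² + b²` avoids halving in `ENNReal` and costs only the
  -- factor 2.
  calc ∫⁻ p : X × X, f p.1 * f p.2 * k p.1 p.2 ∂μ.prod μ
      ≤ ∫⁻ p : X × X, f p.1 ^ 2 * k p.1 p.2 + f p.2 ^ 2 * k p.1 p.2 ∂μ.prod μ := by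
        refine lintegral_mono fun p => ?_
        rw [← add_mul]
        gcongr
        rcases le_total (f p.1) (f p.2) with h | h
        · calc f p.1 * f p.2 ≤ f p.2 * f p.2 := by gcongr
            _ ≤ _ := by rw [← sq]; exact le_add_self
        · calc f p.1 * f p.2 ≤ f p.1 * f p.1 := by gcongr
            _ ≤ _ := by rw [← sq]; exact le_self_add
    _ ≤ _ := by
        rw [lintegral_add_left' hm1, mul_assoc,
          two_mul]
        exact add_le_add h1 h2

/-- The Fourier transform of a Gaussian, paired with two plane waves. -/
theorem integral_gaussian_mul_planeWave_mul_conj {d : ℕ} {ε : ℝ} (hε : 0 < ε)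
    (ξ η : Metric.sphere (0 : EuclideanSpace ℝ (Fin d)) 1) :
    ∫ x, (Real.exp (-ε * ‖x‖ ^ 2) : ℂ) * (planeWave x ξ * conj (planeWave x η))
      = (((Real.pi / ε) ^ ((d : ℝ) / 2) *
          Real.exp (-‖(ξ : EuclideanSpace ℝ (Fin d)) - η‖ ^ 2 / (4 * ε)) : ℝ) : ℂ) := by
  have h := GaussianFourier.integral_cexp_neg_mul_sq_norm_add (b := (ε : ℂ)) (by simpa using hε)
    Complex.I ((ξ : EuclideanSpace ℝ (Fin d)) - η)
  rw [finrank_euclideanSpace_fin] at h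
  have e : ∀ x : EuclideanSpace ℝ (Fin d),
      (Real.exp (-ε * ‖x‖ ^ 2) : ℂ) * (planeWave x ξ * conj (planeWave x η))
        = Complex.exp (-(ε : ℂ) * ‖x‖ ^ 2 + Complex.I *
            (inner ℝ ((ξ : EuclideanSpace ℝ (Fin d)) - η) x : ℝ)) := by
    intro x
    simp only [planeWave, ContinuousMap.coe_mk, ← Complex.exp_conj, Complex.ofReal_exp,
      ← Complex.exp_add, map_mul, Complex.conj_I, Complex.conj_ofReal]
    congr 1
    rw [inner_sub_left, real_inner_comm x, real_inner_comm x]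
    push_cast
    ring
  rw [integral_congr_ae (Filter.Eventually.of_forall e), h, Complex.ofReal_mul,
    Complex.ofReal_cpow (by positivity), Complex.ofReal_exp, Complex.I_sq]
  push_cast
  congr 2
  ring

/-- This justifies Fubini: the Gaussian is integrable, `φ` is `L¹` because the sphere has finite
measure, and the plane waves have modulus 1. -/
theorem integrable_gaussian_mul_planeWave_prod {d : ℕ} {ε : ℝ} (hε : 0 < ε)
    (φ : Lp ℂ 2 (surfaceMeasure d)) :
    Integrable (fun z : EuclideanSpace ℝ (Fin d) ×
        (Metric.sphere (0 : EuclideanSpace ℝ (Fin d)) 1 ×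
          Metric.sphere (0 : EuclideanSpace ℝ (Fin d)) 1) =>
      (Real.exp (-ε * ‖z.1‖ ^ 2) : ℂ) * (φ z.2.1 * conj (φ z.2.2)) *
        (planeWave z.1 z.2.1 * conj (planeWave z.1 z.2.2)))
      (volume.prod ((surfaceMeasure d).prod (surfaceMeasure d))) := by
  have hφ : Integrable φ (surfaceMeasure d) := (Lp.memLp φ).integrable (by norm_num)
  have hφ' : Integrable (fun η => conj (φ η)) (surfaceMeasure d) :=
    hφ.congr' (RCLike.continuous_conj.comp_aestronglyMeasurable hφ.1)
      (Filter.Eventually.of_forall fun η => by simp)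
  have hg : Integrable (fun x : EuclideanSpace ℝ (Fin d) =>
      (Real.exp (-ε * ‖x‖ ^ 2) : ℂ)) volume := by
    refine (GaussianFourier.integrable_cexp_neg_mul_sq_norm_add (b := (ε : ℂ))
      (by simpa using hε) 0 (0 : EuclideanSpace ℝ (Fin d))).congr
      (Filter.Eventually.of_forall fun x => ?_)
    simp
  refine (hg.mul_prod (hφ.mul_prod hφ')).mul_bdd (c := 1) (Continuous.aestronglyMeasurable ?_)
    (Filter.Eventually.of_forall fun z => ?_)
  · simp only [planeWave, ContinuousMap.coe_mk]
    fun_prop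
  · simp [norm_planeWave]

/-- Writing `|u|² = u ū` as a double integral over the sphere and integrating in `x` first leaves
the Fourier transform of the Gaussian at `ξ - η`. The resulting kernel is positive, so Schur's test
applies. -/
theorem integral_gaussian_mul_herglotzTransform {d : ℕ} {ε : ℝ} (hε : 0 < ε)
    (φ : Lp ℂ 2 (surfaceMeasure d)) :
    ((∫ x, Real.exp (-ε * ‖x‖ ^ 2) * ‖herglotzTransform d φ x‖ ^ 2 : ℝ) : ℂ)
      = (herglotzConst d : ℂ) ^ 2 *
        ∫ p : _ × _, φ p.1 * conj (φ p.2) * (((Real.pi / ε) ^ ((d : ℝ) / 2) *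
          Real.exp (-‖(p.1 : EuclideanSpace ℝ (Fin d)) - p.2‖ ^ 2 / (4 * ε)) : ℝ) : ℂ)
          ∂(surfaceMeasure d).prod (surfaceMeasure d) := by
  have h1 : ∀ x : EuclideanSpace ℝ (Fin d),
      ((Real.exp (-ε * ‖x‖ ^ 2) * ‖herglotzTransform d φ x‖ ^ 2 : ℝ) : ℂ)
        = (herglotzConst d : ℂ) ^ 2 * ∫ p : _ × _, (Real.exp (-ε * ‖x‖ ^ 2) : ℂ) *
          (φ p.1 * conj (φ p.2)) * (planeWave x p.1 * conj (planeWave x p.2))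
          ∂(surfaceMeasure d).prod (surfaceMeasure d) := by
    intro x
    have h2 : ∫ p : _ × _, (Real.exp (-ε * ‖x‖ ^ 2) : ℂ) *
          (φ p.1 * conj (φ p.2)) * (planeWave x p.1 * conj (planeWave x p.2))
          ∂(surfaceMeasure d).prod (surfaceMeasure d)
        = (Real.exp (-ε * ‖x‖ ^ 2) : ℂ) * ((∫ ξ, φ ξ * planeWave x ξ ∂surfaceMeasure d) *
          ∫ η, conj (φ η * planeWave x η) ∂surfaceMeasure d) := by
      rw [← integral_prod_mul, ← integral_const_mul]
      refine integral_congr_ae (Filter.Eventually.of_forall fun p => ?_)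
      simp only [map_mul]
      ring
    rw [h2, integral_conj, Complex.ofReal_mul, Complex.ofReal_pow, ← Complex.mul_conj',
      herglotzTransform_apply, map_mul, Complex.conj_ofReal]
    ring
  rw [← integral_complex_ofReal, integral_congr_ae (Filter.Eventually.of_forall h1),
    integral_const_mul, integral_integral_swap (integrable_gaussian_mul_planeWave_prod hε φ)]
  congr 1
  refine integral_congr_ae (Filter.Eventually.of_forall fun p => ?_)
  simp only
  rw [← integral_gaussian_mul_planeWave_mul_conj hε, ← integral_const_mul]
  refine integral_congr_ae (Filter.Eventually.of_forall fun x => ?_)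
  simp only
  ring

/-- The Agmon–Hörmander trace estimate in Gaussian form. -/
theorem exists_lintegral_gaussian_mul_herglotzTransform_le (d : ℕ) :
    ∃ D : ℝ, 0 ≤ D ∧ ∀ (φ : Lp ℂ 2 (surfaceMeasure d)) (ε : ℝ), 0 < ε →
      ∫⁻ x, ENNReal.ofReal (Real.exp (-ε * ‖x‖ ^ 2)) * ‖herglotzTransform d φ x‖ₑ ^ 2
        ≤ ENNReal.ofReal (D * ε ^ (-(1 / 2) : ℝ)) * ‖φ‖ₑ ^ 2 := by
  refine ⟨herglotzConst d ^ 2 * (2 * (Real.exp (1 / 4) * (8 * Real.pi ^ 2) ^ ((d : ℝ) / 2))),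
    by positivity, fun φ ε hε => ?_⟩
  set k : Metric.sphere (0 : EuclideanSpace ℝ (Fin d)) 1 →
      Metric.sphere (0 : EuclideanSpace ℝ (Fin d)) 1 → ENNReal := fun ξ η =>
    ENNReal.ofReal ((Real.pi / ε) ^ ((d : ℝ) / 2)) *
      ENNReal.ofReal (Real.exp (-‖(ξ : EuclideanSpace ℝ (Fin d)) - η‖ ^ 2 / (4 * ε))) with hk
  have hkm : Measurable (Function.uncurry k) := by
    simp only [hk, Function.uncurry_def]
    fun_prop
  have hM : ∀ η, ∫⁻ ξ, k ξ η ∂surfaceMeasure d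
      ≤ ENNReal.ofReal (Real.exp (1 / 4) * (8 * Real.pi ^ 2) ^ ((d : ℝ) / 2) *
          ε ^ (-(1 / 2) : ℝ)) := by
    intro η
    have h0 : ENNReal.ofReal (√ε) ≠ 0 := by simpa using hε
    rw [lintegral_const_mul _ (by fun_prop)]
    -- The shell estimate carries the factor `√ε` on its left side, so both sides are multiplied by
    -- it; the powers of `ε` in `(π/ε)^(d/2) (8πε)^(d/2)` then cancel.
    rw [← ENNReal.mul_le_mul_iff_left h0 ENNReal.ofReal_ne_top, mul_assoc]
    refine (mul_le_mul_right (lintegral_sphere_gaussian_le hε) _).trans_eq ?_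
    rw [← ENNReal.ofReal_mul (by positivity), ← ENNReal.ofReal_mul (by positivity),
      Real.rpow_neg hε.le, ← Real.sqrt_eq_rpow, inv_mul_cancel_right₀ (Real.sqrt_pos.2 hε).ne',
      mul_left_comm, ← Real.mul_rpow (by positivity) (by positivity)]
    congr 3
    field_simp
  have hint : Integrable (fun x : EuclideanSpace ℝ (Fin d) =>
      Real.exp (-ε * ‖x‖ ^ 2) * ‖herglotzTransform d φ x‖ ^ 2) volume := by
    have h := (GaussianFourier.integrable_cexp_neg_mul_sq_norm_add (b := (ε : ℂ))
      (by simpa using hε) 0 (0 : EuclideanSpace ℝ (Fin d))).norm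
    refine Integrable.mul_bdd (c := (herglotzConst d * ∫ ξ, ‖φ ξ‖ ∂surfaceMeasure d) ^ 2)
      (h.congr (Filter.Eventually.of_forall fun x => ?_))
      ((continuous_herglotzTransform φ).norm.pow 2).aestronglyMeasurable
      (Filter.Eventually.of_forall fun x => ?_)
    · simp only [Complex.norm_exp]
      simp [← Complex.ofReal_pow]
    · rw [norm_pow, norm_norm]
      exact pow_le_pow_left₀ (norm_nonneg _) (norm_herglotzTransform_le φ x) 2
  have h2 : ∀ X : ℝ, 2 * ENNReal.ofReal X = ENNReal.ofReal (2 * X) := fun X => by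
    rw [ENNReal.ofReal_mul two_pos.le, ENNReal.ofReal_ofNat]
  calc ∫⁻ x, ENNReal.ofReal (Real.exp (-ε * ‖x‖ ^ 2)) * ‖herglotzTransform d φ x‖ₑ ^ 2
      = ENNReal.ofReal (∫ x, Real.exp (-ε * ‖x‖ ^ 2) * ‖herglotzTransform d φ x‖ ^ 2) := by
        rw [ofReal_integral_eq_lintegral_ofReal hint
          (Filter.Eventually.of_forall fun x => by positivity)]
        refine lintegral_congr fun x => ?_
        rw [ENNReal.ofReal_mul (Real.exp_pos _).le, ENNReal.ofReal_pow (norm_nonneg _),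
          ofReal_norm]
    -- The nonnegative integral is read as the modulus of a complex number, so that the complex
    -- double integral can be estimated by absolute values.
    _ = ‖((∫ x, Real.exp (-ε * ‖x‖ ^ 2) * ‖herglotzTransform d φ x‖ ^ 2 : ℝ) : ℂ)‖ₑ := by
        rw [← ofReal_norm, Complex.norm_of_nonneg]
        exact integral_nonneg fun x => by positivity
    _ ≤ ENNReal.ofReal (herglotzConst d ^ 2) *
          ∫⁻ p : _ × _, ‖φ p.1‖ₑ * ‖φ p.2‖ₑ * k p.1 p.2
            ∂(surfaceMeasure d).prod (surfaceMeasure d) := by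
        rw [integral_gaussian_mul_herglotzTransform hε, enorm_mul]
        refine mul_le_mul' (le_of_eq ?_) ((enorm_integral_le_lintegral_enorm _).trans_eq ?_)
        · rw [← ofReal_norm, norm_pow, Complex.norm_of_nonneg (herglotzConst_pos d).le]
        · refine lintegral_congr fun p => ?_
          simp only [hk]
          rw [enorm_mul, enorm_mul, RCLike.enorm_conj, ← ENNReal.ofReal_mul (by positivity),
            ← ofReal_norm (Complex.ofReal _), Complex.norm_of_nonneg (by positivity)]
    _ ≤ ENNReal.ofReal (herglotzConst d ^ 2) * (2 * ENNReal.ofReal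
          (Real.exp (1 / 4) * (8 * Real.pi ^ 2) ^ ((d : ℝ) / 2) * ε ^ (-(1 / 2) : ℝ)) *
            ∫⁻ ξ, ‖φ ξ‖ₑ ^ 2 ∂surfaceMeasure d) := by
        gcongr
        refine lintegral_prod_mul_mul_le_of_schur
          (Lp.aestronglyMeasurable φ).enorm hkm (fun ξ => ?_) hM
        refine le_trans (le_of_eq (lintegral_congr fun η => ?_)) (hM ξ)
        simp only [hk, norm_sub_rev]
    _ = _ := by
        rw [lintegral_enorm_sq_eq, ← mul_assoc,
          h2,
          ← ENNReal.ofReal_mul (by positivity)]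
        congr 2
        ring

/-! ### From Gaussian to polynomial weights -/

theorem lintegral_rpow_mul_exp_neg_mul_Ioi {a r : ℝ} (ha : 0 < a) (hr : 0 < r) :
    ∫⁻ t in Set.Ioi (0 : ℝ), ENNReal.ofReal (t ^ (a - 1) * Real.exp (-(r * t)))
      = ENNReal.ofReal ((1 / r) ^ a * Real.Gamma a) := by
  have h := Real.integral_rpow_mul_exp_neg_mul_Ioi ha hr
  rw [← h, ofReal_integral_eq_lintegral_ofReal]
  -- A non-integrable function has Bochner integral 0, so the positive value of the Gamma integral
  -- already forces integrability.
  · refine Integrable.of_integral_ne_zero ?_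
    rw [h]
    have := Real.Gamma_pos_of_pos ha
    positivity
  · refine (ae_restrict_iff' measurableSet_Ioi).2 (Filter.Eventually.of_forall fun t ht => ?_)
    have : (0 : ℝ) < t := ht
    change 0 ≤ t ^ (a - 1) * Real.exp (-(r * t))
    positivity

/-- The polynomially weighted `L²` bound for Herglotz functions, by superposition of Gaussian
weights. -/
theorem exists_lintegral_rpow_mul_herglotzTransform_le (d : ℕ) {s : ℝ} (hs : 1 / 2 < s) :
    ∃ K : ENNReal, K ≠ ⊤ ∧ ∀ φ : Lp ℂ 2 (surfaceMeasure d),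
      ∫⁻ x, ENNReal.ofReal ((1 + ‖x‖ ^ 2) ^ (-s)) * ‖herglotzTransform d φ x‖ₑ ^ 2
        ≤ K * ‖φ‖ₑ ^ 2 := by
  obtain ⟨D, hD, h⟩ := exists_lintegral_gaussian_mul_herglotzTransform_le d
  have hG : 0 < Real.Gamma s := Real.Gamma_pos_of_pos (by linarith)
  have hG0 : ENNReal.ofReal (Real.Gamma s) ≠ 0 := by simpa using hG
  refine ⟨(ENNReal.ofReal (Real.Gamma s))⁻¹ *
    (ENNReal.ofReal D * ENNReal.ofReal (Real.Gamma (s - 1 / 2))),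
    ENNReal.mul_ne_top (ENNReal.inv_ne_top.2 hG0)
      (ENNReal.mul_ne_top ENNReal.ofReal_ne_top ENNReal.ofReal_ne_top), fun φ => ?_⟩
  have hu := (continuous_herglotzTransform φ).measurable
  have hw : ∀ x : EuclideanSpace ℝ (Fin d), ENNReal.ofReal ((1 + ‖x‖ ^ 2) ^ (-s))
      = (ENNReal.ofReal (Real.Gamma s))⁻¹ * ∫⁻ t in Set.Ioi (0 : ℝ),
        ENNReal.ofReal (t ^ (s - 1) * Real.exp (-((1 + ‖x‖ ^ 2) * t))) := by
    intro x
    have hx : (0 : ℝ) < 1 + ‖x‖ ^ 2 := by positivity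
    rw [lintegral_rpow_mul_exp_neg_mul_Ioi (by linarith) hx, ENNReal.ofReal_mul (by positivity),
      mul_comm, mul_assoc, ENNReal.mul_inv_cancel hG0 ENNReal.ofReal_ne_top, mul_one,
      Real.rpow_neg hx.le, one_div, Real.inv_rpow hx.le]
  calc ∫⁻ x, ENNReal.ofReal ((1 + ‖x‖ ^ 2) ^ (-s)) * ‖herglotzTransform d φ x‖ₑ ^ 2
      = (ENNReal.ofReal (Real.Gamma s))⁻¹ * ∫⁻ x, ∫⁻ t in Set.Ioi (0 : ℝ),
          ENNReal.ofReal (t ^ (s - 1) * Real.exp (-((1 + ‖x‖ ^ 2) * t))) *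
            ‖herglotzTransform d φ x‖ₑ ^ 2 := by
        rw [← lintegral_const_mul' _ _ (ENNReal.inv_ne_top.2 hG0)]
        refine lintegral_congr fun x => ?_
        rw [hw, mul_assoc, lintegral_mul_const _ (by fun_prop)]
    _ = (ENNReal.ofReal (Real.Gamma s))⁻¹ * ∫⁻ t in Set.Ioi (0 : ℝ), ∫⁻ x,
          ENNReal.ofReal (t ^ (s - 1) * Real.exp (-((1 + ‖x‖ ^ 2) * t))) *
            ‖herglotzTransform d φ x‖ₑ ^ 2 := by
        rw [lintegral_lintegral_swap]
        exact Measurable.aemeasurable (by fun_prop)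
    -- The Gaussian estimate with `ε = t` contributes `t^(-1/2)`, which shifts the Gamma integral
    -- from `s` to `s - 1/2`.
    _ ≤ (ENNReal.ofReal (Real.Gamma s))⁻¹ * ∫⁻ t in Set.Ioi (0 : ℝ),
          ENNReal.ofReal D * ENNReal.ofReal (t ^ (s - 1 / 2 - 1) * Real.exp (-(1 * t))) *
            ‖φ‖ₑ ^ 2 := by
        refine mul_le_mul_right (setLIntegral_mono' measurableSet_Ioi fun t ht => ?_) _
        have ht : (0 : ℝ) < t := ht
        calc ∫⁻ x, ENNReal.ofReal (t ^ (s - 1) * Real.exp (-((1 + ‖x‖ ^ 2) * t))) *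
              ‖herglotzTransform d φ x‖ₑ ^ 2
            = ENNReal.ofReal (t ^ (s - 1) * Real.exp (-t)) *
              ∫⁻ x, ENNReal.ofReal (Real.exp (-t * ‖x‖ ^ 2)) *
                ‖herglotzTransform d φ x‖ₑ ^ 2 := by
              rw [← lintegral_const_mul' _ _ ENNReal.ofReal_ne_top]
              refine lintegral_congr fun x => ?_
              rw [← mul_assoc, ← ENNReal.ofReal_mul (by positivity), mul_assoc, ← Real.exp_add]
              congr 4
              ring
          _ ≤ ENNReal.ofReal (t ^ (s - 1) * Real.exp (-t)) *
              (ENNReal.ofReal (D * t ^ (-(1 / 2) : ℝ)) * ‖φ‖ₑ ^ 2) := by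
              gcongr
              exact h φ t ht
          _ = _ := by
              rw [← mul_assoc, ← ENNReal.ofReal_mul (by positivity), ← ENNReal.ofReal_mul hD,
                show s - 1 / 2 - 1 = (s - 1) + -(1 / 2) by ring, Real.rpow_add ht, one_mul]
              congr 2
              ring
    _ = _ := by
        rw [lintegral_mul_const _ (by fun_prop), lintegral_const_mul _ (by fun_prop),
          lintegral_rpow_mul_exp_neg_mul_Ioi (by linarith) one_pos, ← mul_assoc]
        simp

/-! ### Point evaluations on `ℋ` -/

namespace HerglotzSpace

theorem coe_eq_herglotzTransform {d : ℕ} (u : HerglotzSpace d) :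
    ⇑u = herglotzTransform d ((ofDensity d).symm u) := by
  rw [← toFunLinear_ofDensity, LinearEquiv.apply_symm_apply]
  rfl

theorem enorm_symm_ofDensity {d : ℕ} (u : HerglotzSpace d) : ‖(ofDensity d).symm u‖ₑ = ‖u‖ₑ := by
  rw [← ofReal_norm, ← ofReal_norm, norm_def]

theorem continuous_coe {d : ℕ} (u : HerglotzSpace d) : Continuous u := by
  rw [coe_eq_herglotzTransform]
  exact continuous_herglotzTransform _

/-- Point evaluations are uniformly bounded. -/
theorem exists_enorm_apply_le (d : ℕ) :
    ∃ M : ENNReal, M ≠ ⊤ ∧ ∀ (u : HerglotzSpace d) (x : EuclideanSpace ℝ (Fin d)),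
      ‖u x‖ₑ ≤ M * ‖u‖ₑ := by
  set c : ENNReal := ‖ContinuousMap.toLp (E := ℂ) 2 (surfaceMeasure d) ℂ‖ₑ with hc
  refine ⟨ENNReal.ofReal (herglotzConst d) * c,
    ENNReal.mul_ne_top ENNReal.ofReal_ne_top enorm_ne_top, fun u x => ?_⟩
  rw [coe_eq_herglotzTransform, herglotzTransform_eq_inner, enorm_mul, mul_assoc,
    ← enorm_symm_ofDensity]
  refine mul_le_mul' (le_of_eq ?_) ?_
  · rw [← ofReal_norm, Complex.norm_of_nonneg (herglotzConst_pos d).le]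
  · rw [hc, ← ofReal_norm, ← ofReal_norm, ← ofReal_norm,
      ← ENNReal.ofReal_mul (norm_nonneg _)]
    refine ENNReal.ofReal_le_ofReal ((norm_inner_le_norm _ _).trans ?_)
    gcongr
    refine (ContinuousLinearMap.le_opNorm _ _).trans (mul_le_of_le_one_right (norm_nonneg _) ?_)
    exact (ContinuousMap.norm_le _ zero_le_one).2 fun ξ => (norm_planeWave _ ξ).le

end HerglotzSpace

open HerglotzSpace

/-! ### The Carleson bound and the form `F_a` -/

/-- A homogeneously dominated symbol of degree `< -1` is a Carleson weight for `ℋ`. -/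
theorem IsHomogeneouslyDominated.exists_lintegral_le {d : ℕ} {lam : ℝ} (hlam : lam < -1)
    {a : EuclideanSpace ℝ (Fin d) → ℂ} (ha : IsHomogeneouslyDominated a lam) :
    ∃ K : ENNReal, K ≠ ⊤ ∧ ∀ u : HerglotzSpace d,
      ∫⁻ x, ‖a x‖ₑ * ‖u x‖ₑ ^ 2 ≤ K * ‖u‖ₑ ^ 2 := by
  obtain ⟨hloc, A, R, hA⟩ := ha
  obtain ⟨M, hM, hMu⟩ := exists_enorm_apply_le d
  -- With `s = -lam / 2` the weight decays like `|x|^lam`, and `s > 1/2` is the hypothesis `lam <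
  -- -1`.
  obtain ⟨K, hK, hKu⟩ := exists_lintegral_rpow_mul_herglotzTransform_le d
    (s := -lam / 2) (by linarith)
  -- Beyond radius `R` the domination of `a` holds; beyond radius 1 one has `1 + |x|² ≤ 2|x|²`,
  -- which is the source of the factor `2 ^ (-lam / 2)` in `b`.
  set B := Metric.closedBall (0 : EuclideanSpace ℝ (Fin d)) (max R 1) with hB
  have hfin : ∫⁻ x in B, ‖a x‖ₑ ≠ ⊤ :=
    (hloc.integrableOn_isCompact (isCompact_closedBall _ _)).2.ne
  set b : ENNReal := ENNReal.ofReal (|A| * 2 ^ (-lam / 2))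
  refine ⟨(∫⁻ x in B, ‖a x‖ₑ) * M ^ 2 + b * K,
    ENNReal.add_ne_top.2 ⟨ENNReal.mul_ne_top hfin (ENNReal.pow_ne_top hM),
      ENNReal.mul_ne_top ENNReal.ofReal_ne_top hK⟩, fun u => ?_⟩
  have hin : ∫⁻ x in B, ‖a x‖ₑ * ‖u x‖ₑ ^ 2 ≤ (∫⁻ x in B, ‖a x‖ₑ) * M ^ 2 * ‖u‖ₑ ^ 2 := by
    rw [mul_assoc, ← mul_pow,
      ← lintegral_mul_const' _ _ (ENNReal.pow_ne_top (ENNReal.mul_ne_top hM enorm_ne_top))]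
    refine lintegral_mono fun x => ?_
    gcongr
    exact hMu u x
  have hout : ∫⁻ x in Bᶜ, ‖a x‖ₑ * ‖u x‖ₑ ^ 2 ≤ b * K * ‖u‖ₑ ^ 2 := by
    rw [mul_assoc, ← enorm_symm_ofDensity]
    refine le_trans ?_ (mul_le_mul_right (hKu ((ofDensity d).symm u)) b)
    rw [← lintegral_const_mul' _ _ ENNReal.ofReal_ne_top]
    refine le_trans ?_ (setLIntegral_le_lintegral Bᶜ _)
    refine setLIntegral_mono_ae' Metric.isClosed_closedBall.measurableSet.compl ?_
    filter_upwards [hA] with x hx hxB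
    have hx1 : max R 1 < ‖x‖ := by simpa [hB] using hxB
    have hx0 : 1 < ‖x‖ := (le_max_right _ _).trans_lt hx1
    rw [← coe_eq_herglotzTransform, ← mul_assoc]
    refine mul_le_mul_left ?_ _
    rw [← ENNReal.ofReal_mul (by positivity), ← ofReal_norm]
    refine ENNReal.ofReal_le_ofReal ((hx ((le_max_left _ _).trans hx1.le)).trans ?_)
    rw [mul_assoc]
    refine mul_le_mul (le_abs_self A) ?_ (by positivity) (abs_nonneg A)
    have h2 : ‖x‖ ^ lam = (‖x‖ ^ 2) ^ (-(-lam / 2)) := by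
      rw [← Real.rpow_natCast, ← Real.rpow_mul (norm_nonneg x)]
      congr 1
      push_cast
      ring
    have h3 : (2 : ℝ) ^ (-lam / 2) = (1 / 2) ^ (-(-lam / 2)) := by
      rw [one_div, Real.inv_rpow two_pos.le, Real.rpow_neg two_pos.le, inv_inv]
    rw [h2, h3, ← Real.mul_rpow (by norm_num) (by positivity)]
    exact Real.rpow_le_rpow_of_nonpos (by positivity) (by nlinarith) (by linarith)
  rw [← lintegral_add_compl _ (Metric.isClosed_closedBall.measurableSet : MeasurableSet B), add_mul]
  exact add_le_add hin hout

/-- Splitting `|a|` as `|a|^(1/2) |a|^(1/2)` and applying Cauchy–Schwarz polarises the Carleson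
bound with the same constant. -/
theorem IsHomogeneouslyDominated.exists_lintegral_mul_mul_conj_le {d : ℕ} {lam : ℝ}
    (hlam : lam < -1) {a : EuclideanSpace ℝ (Fin d) → ℂ} (ha : IsHomogeneouslyDominated a lam) :
    ∃ K : ENNReal, K ≠ ⊤ ∧ ∀ u v : HerglotzSpace d,
      ∫⁻ x, ‖a x * u x * conj (v x)‖ₑ ≤ K * ‖u‖ₑ * ‖v‖ₑ := by
  obtain ⟨K, hK, h⟩ := ha.exists_lintegral_le hlam
  refine ⟨K, hK, fun u v => ?_⟩
  have ham : AEMeasurable (fun x => ‖a x‖ₑ ^ (1 / 2 : ℝ)) volume :=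
    ha.1.aestronglyMeasurable.enorm.pow_const _
  have hsq : ∀ w : HerglotzSpace d,
      (∫⁻ x, (‖a x‖ₑ ^ (1 / 2 : ℝ) * ‖w x‖ₑ) ^ (2 : ℝ)) ^ (1 / 2 : ℝ)
        ≤ K ^ (1 / 2 : ℝ) * ‖w‖ₑ := by
    intro w
    refine (ENNReal.rpow_le_rpow (z := 1 / 2) (le_trans (le_of_eq ?_) (h w))
      (by norm_num)).trans_eq ?_
    · refine lintegral_congr fun x => ?_
      rw [ENNReal.mul_rpow_of_nonneg _ _ two_pos.le, ← ENNReal.rpow_mul, ENNReal.rpow_two]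
      norm_num
    · rw [ENNReal.mul_rpow_of_nonneg _ _ (by norm_num), ← ENNReal.rpow_natCast,
        ← ENNReal.rpow_mul]
      norm_num
  calc ∫⁻ x, ‖a x * u x * conj (v x)‖ₑ
      = ∫⁻ x, (‖a x‖ₑ ^ (1 / 2 : ℝ) * ‖u x‖ₑ) * (‖a x‖ₑ ^ (1 / 2 : ℝ) * ‖v x‖ₑ) := by
        refine lintegral_congr fun x => ?_
        rw [enorm_mul, enorm_mul, RCLike.enorm_conj, mul_mul_mul_comm,
          ← ENNReal.rpow_add_of_nonneg _ _ (by norm_num) (by norm_num), mul_assoc]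
        norm_num
    _ ≤ _ := ENNReal.lintegral_mul_le_Lp_mul_Lq volume Real.HolderConjugate.two_two
        (ham.mul u.continuous_coe.enorm.aemeasurable) (ham.mul v.continuous_coe.enorm.aemeasurable)
    _ ≤ (K ^ (1 / 2 : ℝ) * ‖u‖ₑ) * (K ^ (1 / 2 : ℝ) * ‖v‖ₑ) := mul_le_mul' (hsq u) (hsq v)
    _ = K * ‖u‖ₑ * ‖v‖ₑ := by
        rw [mul_mul_mul_comm, ← ENNReal.rpow_add_of_nonneg _ _ (by norm_num) (by norm_num),
          mul_assoc]
        norm_num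

theorem IsHomogeneouslyDominated.integrable {d : ℕ} {lam : ℝ} (hlam : lam < -1)
    {a : EuclideanSpace ℝ (Fin d) → ℂ} (ha : IsHomogeneouslyDominated a lam)
    (u v : HerglotzSpace d) : Integrable (fun x => a x * u x * conj (v x)) volume := by
  obtain ⟨K, hK, h⟩ := ha.exists_lintegral_mul_mul_conj_le hlam
  refine ⟨(ha.1.aestronglyMeasurable.mul u.continuous_coe.aestronglyMeasurable).mul
    (RCLike.continuous_conj.comp v.continuous_coe).aestronglyMeasurable, ?_⟩
  exact (h u v).trans_lt (ENNReal.mul_ne_top (ENNReal.mul_ne_top hK enorm_ne_top)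
    enorm_ne_top).lt_top

theorem IsHomogeneouslyDominated.isBoundedSesquilinearForm {d : ℕ} {lam : ℝ} (hlam : lam < -1)
    {a : EuclideanSpace ℝ (Fin d) → ℂ} (ha : IsHomogeneouslyDominated a lam) :
    IsBoundedSesquilinearForm (symbolForm (d := d) a) where
  add_left u₁ u₂ v := by
    simp only [symbolForm, RKHS.coe_add, Pi.add_apply, mul_add, add_mul]
    exact integral_add (ha.integrable hlam u₁ v) (ha.integrable hlam u₂ v)
  smul_left c u v := by
    simp only [symbolForm, RKHS.coe_smul, Pi.smul_apply, smul_eq_mul]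
    rw [← integral_const_mul]
    exact integral_congr_ae (Filter.Eventually.of_forall fun x => by ring)
  add_right u v₁ v₂ := by
    simp only [symbolForm, RKHS.coe_add, Pi.add_apply, map_add, mul_add]
    exact integral_add (ha.integrable hlam u v₁) (ha.integrable hlam u v₂)
  smul_right c u v := by
    simp only [symbolForm, RKHS.coe_smul, Pi.smul_apply, smul_eq_mul, map_mul]
    rw [← integral_const_mul]
    exact integral_congr_ae (Filter.Eventually.of_forall fun x => by ring)
  bound := by
    obtain ⟨K, hK, h⟩ := ha.exists_lintegral_mul_mul_conj_le hlam
    refine ⟨K.toReal, fun u v => ?_⟩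
    have h1 := ENNReal.toReal_mono (ENNReal.mul_ne_top (ENNReal.mul_ne_top hK enorm_ne_top)
      enorm_ne_top) ((enorm_integral_le_lintegral_enorm _).trans (h u v))
    simpa only [symbolForm, ENNReal.toReal_mul, toReal_enorm] using h1

/-! ### The Toeplitz operator -/

/-- A bounded sesquilinear form on `ℋ` is the form of a bounded operator. -/
theorem IsBoundedSesquilinearForm.exists_inner_eq {d : ℕ}
    {F : HerglotzSpace d → HerglotzSpace d → ℂ} (hF : IsBoundedSesquilinearForm F) :
    ∃ T : HerglotzSpace d →L[ℂ] HerglotzSpace d, ∀ u v, inner ℂ v (T u) = F u v := by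
  obtain ⟨C, hC⟩ := hF.bound
  -- The arguments are swapped because the scalar product here is antilinear in its first slot:
  -- `inner ℂ v (T u)` is `⟨T u, v⟩` in the usual notation. Riesz gives `S` with `inner ℂ (S v) u =
  -- F u v`, so `T` is the adjoint of `S`.
  let B : HerglotzSpace d →L⋆[ℂ] HerglotzSpace d →L[ℂ] ℂ :=
    (LinearMap.mk₂'ₛₗ (starRingEnd ℂ) (RingHom.id ℂ) (fun v u => F u v)
      (fun v₁ v₂ u => hF.add_right u v₁ v₂) (fun c v u => hF.smul_right c u v)
      (fun v u₁ u₂ => hF.add_left u₁ u₂ v) (fun c v u => hF.smul_left c u v)).mkContinuous₂ C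
      fun v u => (hC u v).trans_eq (by ring)
  refine ⟨(InnerProductSpace.continuousLinearMapOfBilin B).adjoint, fun u v => ?_⟩
  rw [ContinuousLinearMap.adjoint_inner_right,
    InnerProductSpace.continuousLinearMapOfBilin_apply]
  rfl

theorem theorem8p4 (d : ℕ) (hd : 2 ≤ d) (lam : ℝ) (hlam : lam < -1)
    (a : EuclideanSpace ℝ (Fin d) → ℂ) (ha : IsHomogeneouslyDominated a lam) :
    (∀ u v : HerglotzSpace d, Integrable (fun x => a x * u x * conj (v x)) volume) ∧
    IsBoundedSesquilinearForm (symbolForm (d := d) a) ∧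
    ∃ T : HerglotzSpace d →L[ℂ] HerglotzSpace d,
      (∀ u : HerglotzSpace d, ⇑(T u) = toeplitzFun (symbolForm a) u) ∧
      ∀ u v : HerglotzSpace d, inner ℂ v (T u) = symbolForm a u v := by
  have hF := ha.isBoundedSesquilinearForm hlam
  obtain ⟨T, hT⟩ := hF.exists_inner_eq
  refine ⟨ha.integrable hlam, hF, T, fun u => funext fun x => ?_, hT⟩
  -- Taking `v = κ_x` in the form identity, the reproducing property turns `⟨T u, κ_x⟩` into the
  -- value of `T u` at `x`.
  rw [toeplitzFun, ← hT, RKHS.kerFun_inner]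
  simp
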